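/- A real number $x$ is called computable if there is an algorithm that, given $n \in \mathbb{N}$, outputs a dyadic rational $q$ with $|x - q| \le 2^{-n}$. A family of functions $\varphi_k : (0,1) \to \mathbb{R}$, $k \in \mathbb{N}$, is called (uniformly) computable if there is a single algorithm that, given $k$, $n \in \mathbb{N}$ and successive entries of an arbitrary sequence of integers $(p_m)_{m \ge 0}$ with $|x - p_m 2^{-m}| \le 2^{-m}$ for all $m$ (where $x \in (0,1)$ is arbitrary), outputs, after reading finitely many entries, a dyadic rational $q$ with $|\varphi_k(x) - q| \le 2^{-n}$. A real number $y$ is normal if, for every integer base $b \ge 2$, every nonempty finite word $w$ of digits from $\{0,\dots,b-1\}$ occurs with asymptotic frequency $b^{-|w|}$ among the fractional digits of the $b$-ary expansion of $|y|$ (finite expansions being used whenever possible); otherwise $y$ is non-normal. Suppose that $(\varphi_k)_{k \in \mathbb{N}}$, $\varphi_k : (0,1) \to \mathbb{R}$, is a computable family of functions such that, for every $k \in \mathbb{N}$, 1. $\varphi_k$ is continuously differentiable on $(0,1)$, and 2. the set $\{x \in (0,1) : \varphi_k'(x) = 0\}$ is finite and its elements are computable real numbers (they need not be computable uniformly in $k$).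 Then there is an algorithm computing an $x \in (0,1)$ such that all $\varphi_k(x)$ are non-normal; that is, there is a computable real number $x \in (0,1)$ such that $\varphi_k(x)$ is non-normal for every $k \in \mathbb{N}$. -/

import Mathlib

/-- The word `w` of length `k` occurs at position `i` (positions counted from `0`) among the
fractional digits of `|x|` in base `b`. The digits are those of `|x| mod 1`; for numbers with two
expansions `Real.digits` gives the finite one. -/
def WordOccursAt (b : ℕ) [NeZero b] (x : ℝ) {k : ℕ} (w : Fin k → Fin b) (i : ℕ) : Prop :=
  ∀ j : Fin k, Real.digits (Int.fract |x|) b (i + j) = w j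

open Classical in
/-- The relative frequency with which the word `w` starts at one of the first `M` fractional
digits of `x` in base `b`. -/
noncomputable def wordFrequency (b : ℕ) [NeZero b] (x : ℝ) {k : ℕ} (w : Fin k → Fin b)
    (M : ℕ) : ℝ :=
  (((Finset.range M).filter fun i => WordOccursAt b x w i).card : ℝ) / M

/-- `x` is normal in base `b`: every finite nonempty word `w` of base-`b` digits appears in the
expansion of `x` with asymptotic frequency `b ^ (-|w|)`. -/
def IsNormalInBase (b : ℕ) [NeZero b] (x : ℝ) : Prop :=
  ∀ k : ℕ, 1 ≤ k → ∀ w : Fin k → Fin b,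
    Filter.Tendsto (wordFrequency b x w) Filter.atTop (nhds (1 / (b : ℝ) ^ k))

/-- `x` is an (absolutely) normal number: it is normal in every integer base `b ≥ 2`. -/
def IsNormalNumber (x : ℝ) : Prop :=
  ∀ (b : ℕ) [NeZero b], 2 ≤ b → IsNormalInBase b x

/-- `p` is a (dyadic, fast converging) name of the real number `x`: the `n`-th entry is the
numerator of a dyadic approximation of `x` with denominator `2 ^ n` and error at most `2 ^ (-n)`. -/
def IsRealName (p : ℕ → ℤ) (x : ℝ) : Prop :=
  ∀ n : ℕ, |x - (p n : ℝ) / 2 ^ n| ≤ 1 / 2 ^ n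

/-- `x` is a computable real number: some algorithm outputs, for each `n`, a dyadic approximation
of `x` up to `2 ^ (-n)`. -/
def IsComputableReal (x : ℝ) : Prop :=
  ∃ p : ℕ → ℤ, Computable p ∧ IsRealName p x

/-- The functions `φ 0, φ 1, …` on `I` are computable, uniformly in the index, in the sense of
Type-2 computability: one algorithm `F`, given the index `k`, a precision `n`, and longer and
longer initial segments of an arbitrary name `p` of an arbitrary point `x ∈ I`, after finitely many
entries returns (the numerator of) a dyadic approximation of `φ k x` up to `2 ^ (-n)`; as long as
the part of the name that it has been given does not suffice, it returns `none`. -/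
def IsComputableFamilyOn (I : Set ℝ) (φ : ℕ → ℝ → ℝ) : Prop :=
  ∃ F : ℕ → List ℤ → ℕ → Option ℤ,
    Computable (fun t : ℕ × List ℤ × ℕ => F t.1 t.2.1 t.2.2) ∧
    ∀ k : ℕ, ∀ x ∈ I, ∀ p : ℕ → ℤ, IsRealName p x → ∀ n : ℕ,
      (∃ m : ℕ, ∃ q : ℤ, F k ((List.range m).map p) n = some q) ∧
      ∀ m : ℕ, ∀ q : ℤ, F k ((List.range m).map p) n = some q →
        |φ k x - (q : ℝ) / 2 ^ n| ≤ 1 / 2 ^ n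

/-- The critical points in `I` of a function `f`. -/
def criticalPointsOn (I : Set ℝ) (f : ℝ → ℝ) : Set ℝ :=
  {x : ℝ | x ∈ I ∧ deriv f x = 0}

/-! If, for infinitely many v, the binary digits of y from position v/4 to v all vanish, then the
digit 0 has frequency at least 3/4 along those v, and y is not normal in base 2. Such blocks can be
forced by shrinking dyadic intervals: for each pair (k, j) in turn, pass to a subinterval on which
`|φ k|` is certified to have a zero block from some position u to 4(u+j+1). The limit point of the
intervals is computable and serves all k.

A subinterval exists because finitely many critical points make `φ k` nonconstant on every interval,
so by the intermediate value theorem `|φ k|` takes a value just above some dyadic s/2^u. It is found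
by unbounded search, since the certificate is decidable: the numerator output by the machine on a
finite prefix has residue 1 or 2 modulo a power of 2. As every point of the interval has a name with
that prefix, the certificate holds on the whole interval. -/

/-! ### Non-normality from long blocks of zeros -/

/-- If `|y|` agrees with the dyadic rational `s / 2 ^ u` up to position `v`, then the binary digits
of `y` between the positions `u` and `v` vanish. -/
theorem digits_two_fract_eq_zero {y : ℝ} {s u v i : ℕ} (hlow : (s : ℝ) / 2 ^ u ≤ |y|)
    (hupp : |y| < s / 2 ^ u + 1 / 2 ^ v) (hui : u ≤ i) (hiv : i < v) :
    Real.digits (Int.fract |y|) 2 i = 0 := by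
  have hfl : ⌊|y| * 2 ^ (i + 1)⌋ = (s * 2 ^ (i + 1 - u) : ℤ) := by
    have hs : (s : ℝ) / 2 ^ u * 2 ^ (i + 1) = s * 2 ^ (i + 1 - u) := by
      rw [div_mul_eq_mul_div, div_eq_iff (by positivity), mul_assoc, ← pow_add]
      congr 2; omega
    have hv : (1 : ℝ) / 2 ^ v * 2 ^ (i + 1) ≤ 1 := by
      rw [div_mul_eq_mul_div, one_mul, div_le_one (by positivity)]
      exact pow_le_pow_right₀ (by norm_num) (by omega)
    have hp : (0 : ℝ) < 2 ^ (i + 1) := by positivity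
    rw [Int.floor_eq_iff]
    push_cast
    rw [← hs]
    constructor
    · exact mul_le_mul_of_nonneg_right hlow hp.le
    · have := mul_lt_mul_of_pos_right hupp hp
      rw [add_mul] at this
      linarith
  have hfr : ⌊Int.fract |y| * (2 : ℝ) ^ (i + 1)⌋
      = s * 2 ^ (i + 1 - u) - ⌊|y|⌋ * 2 ^ (i + 1) := by
    have : Int.fract |y| * (2 : ℝ) ^ (i + 1)
        = |y| * 2 ^ (i + 1) - ((⌊|y|⌋ * 2 ^ (i + 1) : ℤ) : ℝ) := by
      rw [← Int.self_sub_floor]; push_cast; ring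
    rw [this, Int.floor_sub_intCast, hfl]
  have hnn : 0 ≤ Int.fract |y| * (2 : ℝ) ^ (i + 1) :=
    mul_nonneg (Int.fract_nonneg _) (by positivity)
  -- Both exponents, i + 1 - u and i + 1, are positive.
  have heven : (2 : ℤ) ∣ ⌊Int.fract |y| * (2 : ℝ) ^ (i + 1)⌋ := by
    rw [hfr]
    exact dvd_sub (Dvd.dvd.mul_left (dvd_pow_self 2 (by omega)) _)
      (Dvd.dvd.mul_left (dvd_pow_self 2 (by omega)) _)
  rw [← Int.natCast_floor_eq_floor hnn] at heven
  have heven' : 2 ∣ ⌊Int.fract |y| * (2 : ℝ) ^ (i + 1)⌋₊ := by exact_mod_cast heven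
  apply Fin.ext
  simpa [Real.digits, Fin.ofNat] using Nat.mod_eq_zero_of_dvd heven'

theorem three_quarters_le_wordFrequency_zero {y : ℝ} {s u v : ℕ} (hlow : (s : ℝ) / 2 ^ u ≤ |y|)
    (hupp : |y| < s / 2 ^ u + 1 / 2 ^ v) (huv : 4 * u ≤ v) (hv : 0 < v) :
    3 / 4 ≤ wordFrequency 2 y (fun _ : Fin 1 => (0 : Fin 2)) v := by
  classical
  unfold wordFrequency
  rw [le_div_iff₀ (by exact_mod_cast hv)]
  have hsub : Finset.Ico u v ⊆ (Finset.range v).filter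
      fun i => WordOccursAt 2 y (fun _ : Fin 1 => (0 : Fin 2)) i := by
    intro i hi
    rw [Finset.mem_Ico] at hi
    refine Finset.mem_filter.2 ⟨Finset.mem_range.2 hi.2, fun j => ?_⟩
    have hj : (j : ℕ) = 0 := by omega
    rw [hj, add_zero]
    exact digits_two_fract_eq_zero hlow hupp hi.1 hi.2
  have hcard := Finset.card_le_card hsub
  rw [Nat.card_Ico] at hcard
  have hcast : ((v - u : ℕ) : ℝ) = v - u := by
    rw [Nat.cast_sub (by omega)]
  have h1 : ((v - u : ℕ) : ℝ) ≤ _ := Nat.cast_le.2 hcard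
  have h2 : (4 * u : ℝ) ≤ v := by exact_mod_cast huv
  rw [hcast] at h1
  refine le_trans ?_ (h1.trans_eq ?_)
  · linarith
  · congr!

theorem not_isNormalNumber_of_dyadic_approx {y : ℝ}
    (h : ∀ j : ℕ, ∃ u s : ℕ, (s : ℝ) / 2 ^ u ≤ |y| ∧ |y| < s / 2 ^ u + 1 / 2 ^ (4 * (u + j + 1))) :
    ¬ IsNormalNumber y := by
  intro hn
  have ht := hn 2 le_rfl 1 le_rfl (fun _ => 0)
  have hlt : (1 / ((2 : ℕ) : ℝ) ^ 1) < 3 / 4 := by norm_num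
  obtain ⟨j, hj⟩ := Filter.eventually_atTop.1 (ht.eventually_lt_const hlt)
  obtain ⟨u, s, h1, h2⟩ := h j
  exact absurd (hj (4 * (u + j + 1)) (by omega))
    (not_lt.2 (three_quarters_le_wordFrequency_zero h1 h2 (by omega) (by omega)))

/-- With n = 4(u+j+1)+2 and N = n - u, the residue puts |q| at s·2^N + 1 or + 2. An error of one
unit leaves |y|·2^n in [s·2^N, s·2^N + 3], inside the window of 4 units that the zero block allows.
-/
theorem not_isNormalNumber_of_int_approx {y : ℝ}
    (h : ∀ j : ℕ, ∃ (u : ℕ) (q : ℤ), |y - (q : ℝ) / 2 ^ (4 * (u + j + 1) + 2)|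
        ≤ 1 / 2 ^ (4 * (u + j + 1) + 2) ∧
      (q.natAbs % 2 ^ (3 * u + 4 * j + 6) = 1 ∨ q.natAbs % 2 ^ (3 * u + 4 * j + 6) = 2)) :
    ¬ IsNormalNumber y := by
  refine not_isNormalNumber_of_dyadic_approx fun j => ?_
  obtain ⟨u, q, hq, hmod⟩ := h j
  set n := 4 * (u + j + 1) + 2 with hn
  set N := 3 * u + 4 * j + 6 with hN
  refine ⟨u, q.natAbs / 2 ^ N, ?_⟩
  have hdm := Nat.div_add_mod q.natAbs (2 ^ N)
  set s := q.natAbs / 2 ^ N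
  have hpn : (0 : ℝ) < 2 ^ n := by positivity
  have hs : (s : ℝ) / 2 ^ u = s * 2 ^ N / 2 ^ n := by
    rw [div_eq_div_iff (by positivity) (by positivity), mul_assoc, ← pow_add]
    congr 2; omega
  have h4 : (1 : ℝ) / 2 ^ (4 * (u + j + 1)) = 4 / 2 ^ n := by
    rw [hn, pow_add]; field_simp; norm_num
  have habs : |(|y| - (q.natAbs : ℝ) / 2 ^ n)| ≤ 1 / 2 ^ n := by
    refine le_trans ?_ hq
    have := abs_abs_sub_abs_le y ((q : ℝ) / 2 ^ n)
    rwa [abs_div, abs_of_pos hpn, ← Int.cast_abs, Int.abs_eq_natAbs, Int.cast_natCast] at this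
  have hQ : (s : ℝ) * 2 ^ N + 1 ≤ q.natAbs ∧ (q.natAbs : ℝ) ≤ s * 2 ^ N + 2 := by
    constructor <;> norm_cast <;> rw [mul_comm] <;> omega
  rw [abs_le, ← sub_nonneg, ← sub_nonneg (b := _ - _)] at habs
  rw [hs, h4, ← add_div, div_le_iff₀ hpn, lt_div_iff₀ hpn]
  have e1 : (|y| - (q.natAbs : ℝ) / 2 ^ n - -(1 / 2 ^ n)) * 2 ^ n = |y| * 2 ^ n - q.natAbs + 1 := by
    field_simp; ring
  have e2 : (1 / 2 ^ n - (|y| - (q.natAbs : ℝ) / 2 ^ n)) * 2 ^ n = 1 - |y| * 2 ^ n + q.natAbs := by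
    field_simp; ring
  have h1 := mul_nonneg habs.1 hpn.le
  have h2 := mul_nonneg habs.2 hpn.le
  rw [e1] at h1
  rw [e2] at h2
  constructor <;> linarith

/-! ### Values of a non-constant continuous function -/

/-- If the absolute values agree, the values are opposite and nonzero, so f vanishes somewhere in
between. -/
theorem exists_abs_ne_of_ne {f : ℝ → ℝ} {S : Set ℝ} (hS : S.OrdConnected) (hf : ContinuousOn f S)
    {x y : ℝ} (hx : x ∈ S) (hy : y ∈ S) (hxy : f x ≠ f y) :
    ∃ z ∈ S, ∃ w ∈ S, |f z| < |f w| := by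
  rcases lt_trichotomy |f x| |f y| with h | h | h
  · exact ⟨x, hx, y, hy, h⟩
  · have hneg : f x = - f y := ((abs_eq_abs.1 h).resolve_left hxy)
    have hne : f x ≠ 0 := fun h0 => hxy (by rw [h0, eq_comm]; linarith)
    have hpre : IsPreconnected (f '' S) := hS.isPreconnected.image f hf
    have h0 : (0 : ℝ) ∈ f '' S := by
      rcases lt_or_gt_of_ne hne with h1 | h1
      · exact hpre.ordConnected.out ⟨x, hx, rfl⟩ ⟨y, hy, rfl⟩ ⟨h1.le, by linarith⟩
      · exact hpre.ordConnected.out ⟨y, hy, rfl⟩ ⟨x, hx, rfl⟩ ⟨by linarith, h1.le⟩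
    obtain ⟨z, hz, hz0⟩ := h0
    exact ⟨z, hz, x, hx, by rw [hz0, abs_zero]; exact abs_pos.2 hne⟩
  · exact ⟨y, hy, x, hx, h⟩

theorem exists_abs_eq_dyadic_add {f : ℝ → ℝ} {S : Set ℝ} (hS : S.OrdConnected)
    (hf : ContinuousOn f S) {x y : ℝ} (hx : x ∈ S) (hy : y ∈ S) (hxy : f x ≠ f y) (j : ℕ) :
    ∃ z ∈ S, ∃ u s : ℕ, |f z| = s / 2 ^ u + 3 / 2 / 2 ^ (4 * (u + j + 1) + 2) := by
  obtain ⟨a, ha, b, hb, hab⟩ := exists_abs_ne_of_ne hS hf hx hy hxy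
  have hpre : IsPreconnected ((fun t => |f t|) '' S) := hS.isPreconnected.image _ hf.abs
  -- Half of the gap is for rounding |f a| up to s/2^u, the other half for the offset beyond it.
  obtain ⟨u, hu⟩ := exists_pow_lt_of_lt_one (half_pos (sub_pos.2 hab))
    (by norm_num : (1 / 2 : ℝ) < 1)
  rw [one_div_pow] at hu
  have hpu : (0 : ℝ) < 2 ^ u := by positivity
  set s := ⌊|f a| * 2 ^ u⌋₊ + 1 with hs
  have h1 : |f a| < (s : ℝ) / 2 ^ u := by
    rw [lt_div_iff₀ hpu, hs]; push_cast; exact Nat.lt_floor_add_one _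
  have h2 : (s : ℝ) / 2 ^ u ≤ |f a| + 1 / 2 ^ u := by
    rw [div_le_iff₀ hpu, hs, add_mul, one_div_mul_cancel hpu.ne']
    push_cast
    have := Nat.floor_le (a := |f a| * 2 ^ u) (by positivity)
    linarith
  have h3 : (3 / 2 : ℝ) / 2 ^ (4 * (u + j + 1) + 2) ≤ 1 / 2 ^ u := by
    have he : 4 * (u + j + 1) + 2 = u + 2 + (3 * u + 4 * j + 4) := by ring
    rw [div_le_div_iff₀ (by positivity) hpu, he, pow_add, pow_add]
    have : (1 : ℝ) ≤ 2 ^ (3 * u + 4 * j + 4) := one_le_pow₀ (by norm_num)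
    nlinarith
  have h4 : (0 : ℝ) < 3 / 2 / 2 ^ (4 * (u + j + 1) + 2) := by positivity
  obtain ⟨z, hz, hzv⟩ := hpre.ordConnected.out ⟨a, ha, rfl⟩ ⟨b, hb, rfl⟩
    (show (s : ℝ) / 2 ^ u + 3 / 2 / 2 ^ (4 * (u + j + 1) + 2) ∈ Set.Icc _ _ from
      ⟨by dsimp only; linarith, by dsimp only; linarith⟩)
  exact ⟨z, hz, u, s, hzv⟩

/-- The offset 3/2 is the centre of the window: with an error of one unit, |q| lies between s·2^N +
1/2 and s·2^N + 5/2, so every admissible output passes the test. -/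
theorem natAbs_mod_of_abs_eq_dyadic_add {y : ℝ} {q : ℤ} {u s j : ℕ}
    (hy : |y| = s / 2 ^ u + 3 / 2 / 2 ^ (4 * (u + j + 1) + 2))
    (hq : |y - (q : ℝ) / 2 ^ (4 * (u + j + 1) + 2)| ≤ 1 / 2 ^ (4 * (u + j + 1) + 2)) :
    q.natAbs % 2 ^ (3 * u + 4 * j + 6) = 1 ∨ q.natAbs % 2 ^ (3 * u + 4 * j + 6) = 2 := by
  set n := 4 * (u + j + 1) + 2 with hn
  set N := 3 * u + 4 * j + 6 with hN
  have hpn : (0 : ℝ) < 2 ^ n := by positivity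
  have hs : (s : ℝ) / 2 ^ u = s * 2 ^ N / 2 ^ n := by
    rw [div_eq_div_iff (by positivity) (by positivity), mul_assoc, ← pow_add]
    congr 2; omega
  have habs : |(|y| - (q.natAbs : ℝ) / 2 ^ n)| ≤ 1 / 2 ^ n := by
    refine le_trans ?_ hq
    have := abs_abs_sub_abs_le y ((q : ℝ) / 2 ^ n)
    rwa [abs_div, abs_of_pos hpn, ← Int.cast_abs, Int.abs_eq_natAbs, Int.cast_natCast] at this
  rw [hy, hs, ← add_div, ← sub_div, abs_div, abs_of_pos hpn, div_le_div_iff_of_pos_right hpn,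
    abs_le] at habs
  have h1 : ((s * 2 ^ N : ℕ) : ℝ) < q.natAbs := by push_cast; linarith
  have h2 : (q.natAbs : ℝ) < ((s * 2 ^ N + 3 : ℕ) : ℝ) := by push_cast; linarith
  rw [Nat.cast_lt] at h1 h2
  have hbig : 2 < 2 ^ N := by
    calc 2 < 2 ^ 6 := by norm_num
      _ ≤ 2 ^ N := Nat.pow_le_pow_right (by norm_num) (by omega)
  have : q.natAbs = s * 2 ^ N + 1 ∨ q.natAbs = s * 2 ^ N + 2 := by omega
  rcases this with h | h <;> rw [h, Nat.mul_add_mod', Nat.mod_eq_of_lt (by omega)] <;> simp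

theorem exists_ne_of_finite_criticalPointsOn {f : ℝ → ℝ} {I : Set ℝ}
    (hfin : (criticalPointsOn I f).Finite) {α β : ℝ} (hαβ : α < β) (hsub : Set.Ioo α β ⊆ I) :
    ∃ x ∈ Set.Ioo α β, ∃ y ∈ Set.Ioo α β, f x ≠ f y := by
  by_contra! hcon
  refine Set.Ioo_infinite hαβ (hfin.subset fun x hx => ⟨hsub hx, ?_⟩)
  have : f =ᶠ[nhds x] fun _ => f x := by
    filter_upwards [isOpen_Ioo.mem_nhds hx] with y hy using hcon y hy x hx
  rw [this.deriv_eq, deriv_const]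

/-! ### Dyadic intervals and initial segments of names -/

/-- The closed dyadic interval `[a / 2 ^ e, (a + 1) / 2 ^ e]`. -/
def dyadicIcc (a e : ℕ) : Set ℝ := Set.Icc ((a : ℝ) / 2 ^ e) (((a : ℝ) + 1) / 2 ^ e)

/-- The first `m` entries of a name shared by all points of `dyadicIcc a e`. -/
def dyadicPrefix (a e m : ℕ) : List ℤ :=
  (List.range m).map fun i => ((a / 2 ^ (e - i) : ℕ) : ℤ)

theorem dyadicIcc_child_subset {a e t r : ℕ} (hr : r < 2 ^ t) :
    dyadicIcc (a * 2 ^ t + r) (e + t) ⊆ dyadicIcc a e := by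
  have hr' : (r : ℝ) + 1 ≤ 2 ^ t := by exact_mod_cast hr
  have ht : (0 : ℝ) < 2 ^ t := by positivity
  have he : (0 : ℝ) < 2 ^ e := by positivity
  refine Set.Icc_subset_Icc ?_ ?_
  · rw [div_le_div_iff₀ he (by positivity), pow_add]
    push_cast
    have : (0 : ℝ) ≤ r * 2 ^ e := by positivity
    nlinarith
  · rw [div_le_div_iff₀ (by positivity) he, pow_add]
    push_cast
    nlinarith

theorem dyadicIcc_subset_div {a e i : ℕ} (hi : i ≤ e) :
    dyadicIcc a e ⊆ dyadicIcc (a / 2 ^ (e - i)) i := by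
  have h := dyadicIcc_child_subset (a := a / 2 ^ (e - i)) (e := i)
    (Nat.mod_lt a (Nat.two_pow_pos (e - i)))
  rwa [Nat.div_add_mod', Nat.add_sub_cancel' hi] at h

theorem abs_sub_le_of_mem_dyadicIcc {x : ℝ} {a e : ℕ} (hx : x ∈ dyadicIcc a e) :
    |x - (a : ℝ) / 2 ^ e| ≤ 1 / 2 ^ e := by
  have h1 := hx.1
  have h2 := hx.2
  rw [add_div] at h2
  rw [abs_le]
  have : (0 : ℝ) < 1 / 2 ^ e := by positivity
  constructor <;> linarith

theorem mem_dyadicIcc_floor {x : ℝ} (hx : 0 ≤ x) (e : ℕ) : x ∈ dyadicIcc ⌊x * 2 ^ e⌋₊ e := by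
  have he : (0 : ℝ) < 2 ^ e := by positivity
  constructor
  · rw [div_le_iff₀ he]
    exact Nat.floor_le (by positivity)
  · rw [le_div_iff₀ he]
    exact (Nat.lt_floor_add_one _).le

theorem isRealName_floor {x : ℝ} (hx : 0 ≤ x) :
    IsRealName (fun n => ((⌊x * 2 ^ n⌋₊ : ℕ) : ℤ)) x := fun n => by
  simpa using abs_sub_le_of_mem_dyadicIcc (mem_dyadicIcc_floor hx n)

theorem exists_isRealName_map_range_eq {x : ℝ} (hx0 : 0 ≤ x) {a e m : ℕ}
    (hx : x ∈ dyadicIcc a e) (hm : m ≤ e) :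
    ∃ p : ℕ → ℤ, IsRealName p x ∧ (List.range m).map p = dyadicPrefix a e m := by
  refine ⟨fun i => if i < m then ((a / 2 ^ (e - i) : ℕ) : ℤ) else ((⌊x * 2 ^ i⌋₊ : ℕ) : ℤ),
    fun n => ?_, ?_⟩
  · dsimp only
    split_ifs with h
    · rw [Int.cast_natCast]
      exact abs_sub_le_of_mem_dyadicIcc (dyadicIcc_subset_div (h.le.trans hm) hx)
    · exact isRealName_floor hx0 n
  · refine List.map_congr_left fun i hi => ?_
    rw [if_pos (List.mem_range.1 hi)]

theorem floor_mul_pow_div {x : ℝ} {i e : ℕ} (hi : i ≤ e) :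
    ⌊x * 2 ^ e⌋₊ / 2 ^ (e - i) = ⌊x * 2 ^ i⌋₊ := by
  rw [← Nat.floor_div_natCast]
  congr 1
  push_cast
  rw [div_eq_iff (by positivity), mul_assoc, ← pow_add, Nat.add_sub_cancel' hi]

theorem dyadicPrefix_floor (x : ℝ) {e m : ℕ} (hm : m ≤ e) :
    dyadicPrefix ⌊x * 2 ^ e⌋₊ e m = (List.range m).map fun n => ((⌊x * 2 ^ n⌋₊ : ℕ) : ℤ) :=
  List.map_congr_left fun i hi => by
    rw [floor_mul_pow_div ((List.mem_range.1 hi).le.trans hm)]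

/-- The interval is open so that the floor of x at level e is exactly a; deeper floors then describe
subintervals of it. -/
theorem exists_child_eq_floor {x : ℝ} {a e : ℕ} (hx : x ∈ Set.Ioo ((a : ℝ) / 2 ^ e) ((a + 1) / 2 ^ e))
    (m : ℕ) : ∃ t r : ℕ, r < 2 ^ (t + 1) ∧ m ≤ e + (t + 1) ∧
      a * 2 ^ (t + 1) + r = ⌊x * 2 ^ (e + (t + 1))⌋₊ := by
  refine ⟨m, ⌊x * 2 ^ (e + (m + 1))⌋₊ % 2 ^ (m + 1), Nat.mod_lt _ (Nat.two_pow_pos _), by omega, ?_⟩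
  have h : ⌊x * 2 ^ (e + (m + 1))⌋₊ / 2 ^ (m + 1) = a := by
    have := floor_mul_pow_div (x := x) (Nat.le_add_right e (m + 1))
    rw [Nat.add_sub_cancel_left] at this
    have hx0 : 0 ≤ x := le_trans (by positivity) hx.1.le
    rw [this, Nat.floor_eq_iff (by positivity)]
    have he : (0 : ℝ) < 2 ^ e := by positivity
    exact ⟨((div_lt_iff₀ he).1 hx.1).le, (lt_div_iff₀ he).1 hx.2⟩
  conv_lhs => rw [← h]
  exact Nat.div_add_mod' _ _

/-! ### Computability of the auxiliary operations -/

theorem Primrec.nat_two_pow : Primrec fun n : ℕ => 2 ^ n :=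
  (Primrec.nat_rec₁ 1 (Primrec.nat_mul.comp (Primrec.const 2) Primrec.snd).to₂).of_eq fun n => by
    induction n with
    | zero => rfl
    | succ n ih => rw [pow_succ', ← ih]

theorem Primrec.int_ofNat : Primrec fun n : ℕ => (n : ℤ) :=
  Primrec.encode_iff.1 ((Primrec.nat_mul.comp (Primrec.const 2) Primrec.id).of_eq fun _ => rfl)

/-- The encoding of ℤ sends n to 2n and -(n+1) to 2n+1. -/
theorem Primrec.int_natAbs : Primrec Int.natAbs :=
  (Primrec.nat_div.comp (Primrec.succ.comp Primrec.encode) (Primrec.const 2)).of_eq fun z => by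
    cases z with
    | ofNat n =>
      change (2 * n + 1) / 2 = n
      omega
    | negSucc n =>
      change (2 * n + 1 + 1) / 2 = n + 1
      omega

theorem Primrec.dyadicPrefix : Primrec fun s : ℕ × ℕ × ℕ => dyadicPrefix s.1 s.2.1 s.2.2 := by
  refine Primrec.list_map (Primrec.list_range.comp (Primrec.snd.comp Primrec.snd)) ?_
  refine Primrec.int_ofNat.comp (Primrec.nat_div.comp (Primrec.fst.comp Primrec.fst)
    (Primrec.nat_two_pow.comp (Primrec.nat_sub.comp
      (Primrec.fst.comp (Primrec.snd.comp Primrec.fst)) Primrec.snd)))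

theorem ComputablePred.and {α : Type*} [Primcodable α] {p q : α → Prop} (hp : ComputablePred p)
    (hq : ComputablePred q) : ComputablePred fun a => p a ∧ q a := by
  classical
  exact ((Primrec.and.to_comp.comp hp.decide hq.decide).of_eq
    fun a => (Bool.decide_and _ _).symm).computablePred

theorem ComputablePred.or {α : Type*} [Primcodable α] {p q : α → Prop} (hp : ComputablePred p)
    (hq : ComputablePred q) : ComputablePred fun a => p a ∨ q a := by
  classical
  exact ((Primrec.or.to_comp.comp hp.decide hq.decide).of_eq
    fun a => (Bool.decide_or _ _).symm).computablePred

theorem ComputablePred.comp_computable {α β : Type*} [Primcodable α] [Primcodable β] {p : β → Prop}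
    (hp : ComputablePred p) {f : α → β} (hf : Computable f) : ComputablePred fun a => p (f a) := by
  classical
  exact (hp.decide.comp hf).computablePred

/-! ### Effective nested intervals -/

theorem exists_nested_sequence {C : ℕ × ℕ × ℕ × ℕ → Prop} (hC : ComputablePred C)
    (hex : ∀ i a e : ℕ, 0 < a → a + 1 < 2 ^ e →
      ∃ t r w : ℕ, r < 2 ^ (t + 1) ∧ C (i, a * 2 ^ (t + 1) + r, e + (t + 1), w)) :
    ∃ st : ℕ → ℕ × ℕ, Computable st ∧ st 0 = (1, 2) ∧
      ∀ i, 0 < (st i).1 → (st i).1 + 1 < 2 ^ (st i).2 → ∃ t r w : ℕ, r < 2 ^ (t + 1) ∧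
        C (i, (st i).1 * 2 ^ (t + 1) + r, (st i).2 + (t + 1), w) ∧
        st (i + 1) = ((st i).1 * 2 ^ (t + 1) + r, (st i).2 + (t + 1)) := by
  classical
  let ct : ℕ × ℕ → ℕ → ℕ × ℕ := fun s n =>
    (s.1 * 2 ^ (n.unpair.1 + 1) + n.unpair.2.unpair.1, s.2 + (n.unpair.1 + 1))
  have hct : Primrec₂ ct := by
    have h1 : Primrec fun p : (ℕ × ℕ) × ℕ => p.2.unpair.1 + 1 :=
      Primrec.succ.comp (Primrec.fst.comp (Primrec.unpair.comp Primrec.snd))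
    have h2 : Primrec fun p : (ℕ × ℕ) × ℕ => p.2.unpair.2.unpair.1 :=
      Primrec.fst.comp (Primrec.unpair.comp (Primrec.snd.comp (Primrec.unpair.comp Primrec.snd)))
    exact (Primrec.nat_add.comp (Primrec.nat_mul.comp (Primrec.fst.comp Primrec.fst)
      (Primrec.nat_two_pow.comp h1)) h2).pair
      (Primrec.nat_add.comp (Primrec.snd.comp Primrec.fst) h1)
  -- The first alternative makes the search halt on intervals touching 0 or 1 too, so that the step
  -- function is total. The number n codes (t, r, w).
  let P : ℕ × ℕ × ℕ → ℕ → Prop := fun s n =>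
    ¬ (0 < s.2.1 ∧ s.2.1 + 1 < 2 ^ s.2.2) ∨
      (n.unpair.2.unpair.1 < 2 ^ (n.unpair.1 + 1) ∧
        C (s.1, (ct s.2 n).1, (ct s.2 n).2, n.unpair.2.unpair.2))
  have hP : ComputablePred fun p : (ℕ × ℕ × ℕ) × ℕ => P p.1 p.2 := by
    have ha : Primrec fun p : (ℕ × ℕ × ℕ) × ℕ => p.1.2.1 :=
      Primrec.fst.comp (Primrec.snd.comp Primrec.fst)
    have he : Primrec fun p : (ℕ × ℕ × ℕ) × ℕ => p.1.2.2 :=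
      Primrec.snd.comp (Primrec.snd.comp Primrec.fst)
    have ht : Primrec fun p : (ℕ × ℕ × ℕ) × ℕ => p.2.unpair.1 + 1 :=
      Primrec.succ.comp (Primrec.fst.comp (Primrec.unpair.comp Primrec.snd))
    have hrw : Primrec fun p : (ℕ × ℕ × ℕ) × ℕ => p.2.unpair.2.unpair :=
      Primrec.unpair.comp (Primrec.snd.comp (Primrec.unpair.comp Primrec.snd))
    have hc : Primrec fun p : (ℕ × ℕ × ℕ) × ℕ => ct p.1.2 p.2 :=
      hct.comp (Primrec.snd.comp Primrec.fst) Primrec.snd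
    refine ComputablePred.or (PrimrecPred.computablePred ?_)
      (ComputablePred.and (PrimrecPred.computablePred ?_) (hC.comp_computable ?_))
    · exact ((Primrec.nat_lt.comp (Primrec.const 0) ha).and
        (Primrec.nat_lt.comp (Primrec.succ.comp ha) (Primrec.nat_two_pow.comp he))).not
    · exact Primrec.nat_lt.comp (Primrec.fst.comp hrw) (Primrec.nat_two_pow.comp ht)
    · exact ((Primrec.fst.comp Primrec.fst).pair ((Primrec.fst.comp hc).pair
        ((Primrec.snd.comp hc).pair (Primrec.snd.comp hrw)))).to_comp
  have hPex : ∀ s, ∃ n, P s n := by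
    rintro ⟨i, a, e⟩
    by_cases h : 0 < a ∧ a + 1 < 2 ^ e
    · obtain ⟨t, r, w, hr, hw⟩ := hex i a e h.1 h.2
      exact ⟨Nat.pair t (Nat.pair r w), Or.inr (by simpa [ct] using ⟨hr, hw⟩)⟩
    · exact ⟨0, Or.inl h⟩
  let step : ℕ → ℕ × ℕ → ℕ × ℕ := fun i s => ct s (Nat.find (hPex (i, s)))
  have hstep : Computable₂ step :=
    hct.to_comp.comp Computable.snd (Computable.find hP hPex)
  -- The start is [1/4, 1/2], which keeps the limit away from 0 and 1.
  refine ⟨fun n => Nat.rec (1, 2) step n, ?_, rfl, fun i h1 h2 => ?_⟩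
  · exact Computable.nat_rec Computable.id (Computable.const (1, 2))
      (hstep.comp (Computable.fst.comp Computable.snd) (Computable.snd.comp Computable.snd)).to₂
  · set s : ℕ × ℕ := Nat.rec (1, 2) step i with hs
    obtain h | ⟨hr, hw⟩ := Nat.find_spec (hPex (i, s))
    · exact absurd ⟨h1, h2⟩ h
    · exact ⟨_, _, _, hr, hw, rfl⟩

theorem exists_isComputableReal_of_dyadic_refinement {C : ℕ × ℕ × ℕ × ℕ → Prop}
    (hC : ComputablePred C)
    (hex : ∀ i a e : ℕ, 0 < a → a + 1 < 2 ^ e →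
      ∃ t r w : ℕ, r < 2 ^ (t + 1) ∧ C (i, a * 2 ^ (t + 1) + r, e + (t + 1), w)) :
    ∃ x ∈ Set.Ioo (0 : ℝ) 1, IsComputableReal x ∧
      ∀ i, ∃ a e w : ℕ, x ∈ dyadicIcc a e ∧ C (i, a, e, w) := by
  obtain ⟨st, hst, hst0, hnext⟩ := exists_nested_sequence hC hex
  have hinv : ∀ i, 0 < (st i).1 ∧ (st i).1 + 1 < 2 ^ (st i).2 ∧ i ≤ (st i).2 := by
    intro i
    induction i with
    | zero => rw [hst0]; norm_num
    | succ i ih =>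
      obtain ⟨h1, h2, h3⟩ := ih
      obtain ⟨t, r, w, hr, -, heq⟩ := hnext i h1 h2
      rw [heq]
      refine ⟨by positivity, ?_, by dsimp only; omega⟩
      dsimp only
      rw [pow_add _ _ (t + 1)]
      have hT : 0 < 2 ^ (t + 1) := by positivity
      generalize 2 ^ (t + 1) = T at hr hT ⊢
      nlinarith
  choose hpos hlt hle using hinv
  choose t r w hr hw heq using fun i => hnext i (hpos i) (hlt i)
  obtain ⟨x, hx⟩ := IsCompact.nonempty_iInter_of_sequence_nonempty_isCompact_isClosed
    (fun i => dyadicIcc (st i).1 (st i).2)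
    (fun i => by
      rw [heq i]
      exact dyadicIcc_child_subset (hr i))
    (fun i => Set.nonempty_Icc.2 (by gcongr; linarith)) isCompact_Icc (fun i => isClosed_Icc)
  rw [Set.mem_iInter] at hx
  -- Each step adds t + 1 ≥ 1 bits, so stage n has level at least n and its left endpoint can be
  -- truncated to n bits.
  refine ⟨x, ?_, ⟨fun n => (((st n).1 / 2 ^ ((st n).2 - n) : ℕ) : ℤ), ?_, fun n => ?_⟩, fun i => ?_⟩
  · have h := hx 0
    rw [hst0] at h
    have h1 := h.1
    have h2 := h.2
    norm_num at h1 h2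
    constructor <;> linarith
  · exact Primrec.int_ofNat.to_comp.comp (Primrec.nat_div.to_comp.comp (Computable.fst.comp hst)
      (Primrec.nat_two_pow.to_comp.comp
        (Primrec.nat_sub.to_comp.comp (Computable.snd.comp hst) Computable.id)))
  · rw [Int.cast_natCast]
    exact abs_sub_le_of_mem_dyadicIcc (dyadicIcc_subset_div (hle n) (hx n))
  · have h := hx (i + 1)
    rw [heq i] at h
    exact ⟨_, _, _, h, hw i⟩

/-! ### The search predicate -/

/-- The absolute value of the output of a Type-2 machine, and `0` as long as there is none. -/
def outputNatAbs (F : ℕ → List ℤ → ℕ → Option ℤ) (k : ℕ) (l : List ℤ) (n : ℕ) : ℕ :=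
  ((F k l n).map Int.natAbs).getD 0

/-- The machine `F` certifies from `m` entries of a name of the points of `dyadicIcc a e` that the
absolute value of its function with index `k` has binary digits vanishing from position `u` to
position `4 * (u + j + 1)`. -/
def CertifiesZeroBlock (F : ℕ → List ℤ → ℕ → Option ℤ) (k j a e m u : ℕ) : Prop :=
  m ≤ e ∧
    (outputNatAbs F k (dyadicPrefix a e m) (4 * (u + j + 1) + 2) % 2 ^ (3 * u + 4 * j + 6) = 1 ∨
      outputNatAbs F k (dyadicPrefix a e m) (4 * (u + j + 1) + 2) % 2 ^ (3 * u + 4 * j + 6) = 2)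

theorem computable_outputNatAbs {F : ℕ → List ℤ → ℕ → Option ℤ}
    (hF : Computable (fun t : ℕ × List ℤ × ℕ => F t.1 t.2.1 t.2.2)) :
    Computable fun t : ℕ × List ℤ × ℕ => outputNatAbs F t.1 t.2.1 t.2.2 :=
  Computable.option_getD (Computable.option_map hF
    (Primrec.int_natAbs.comp Primrec.snd).to_comp.to₂) (Computable.const 0)

theorem Primrec.zeroBlock_precision :
    Primrec fun s : ℕ × ℕ => 4 * (s.1 + s.2 + 1) + 2 :=
  Primrec.nat_add.comp (Primrec.nat_mul.comp (Primrec.const 4)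
    (Primrec.nat_add.comp (Primrec.nat_add.comp Primrec.fst Primrec.snd) (Primrec.const 1)))
    (Primrec.const 2)

theorem Primrec.zeroBlock_modulus :
    Primrec fun s : ℕ × ℕ => 2 ^ (3 * s.1 + 4 * s.2 + 6) :=
  Primrec.nat_two_pow.comp (Primrec.nat_add.comp (Primrec.nat_add.comp
    (Primrec.nat_mul.comp (Primrec.const 3) Primrec.fst)
    (Primrec.nat_mul.comp (Primrec.const 4) Primrec.snd)) (Primrec.const 6))

theorem computablePred_certifiesZeroBlock {F : ℕ → List ℤ → ℕ → Option ℤ}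
    (hF : Computable (fun t : ℕ × List ℤ × ℕ => F t.1 t.2.1 t.2.2)) :
    ComputablePred fun s : ℕ × ℕ × ℕ × ℕ =>
      CertifiesZeroBlock F s.1.unpair.1 s.1.unpair.2 s.2.1 s.2.2.1 s.2.2.2.unpair.1
        s.2.2.2.unpair.2 := by
  have hk : Primrec fun s : ℕ × ℕ × ℕ × ℕ => s.1.unpair := Primrec.unpair.comp Primrec.fst
  have ha : Primrec fun s : ℕ × ℕ × ℕ × ℕ => s.2.1 := Primrec.fst.comp Primrec.snd
  have he : Primrec fun s : ℕ × ℕ × ℕ × ℕ => s.2.2.1 :=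
    Primrec.fst.comp (Primrec.snd.comp Primrec.snd)
  have hmu : Primrec fun s : ℕ × ℕ × ℕ × ℕ => s.2.2.2.unpair :=
    Primrec.unpair.comp (Primrec.snd.comp (Primrec.snd.comp Primrec.snd))
  have huj := (Primrec.snd.comp hmu).pair (Primrec.snd.comp hk)
  have hpre := Primrec.dyadicPrefix.comp (ha.pair (he.pair (Primrec.fst.comp hmu)))
  have hout := (computable_outputNatAbs hF).comp
    ((Primrec.fst.comp hk).pair (hpre.pair (Primrec.zeroBlock_precision.comp huj))).to_comp
  have hmod := Primrec.nat_mod.to_comp.comp hout (Primrec.zeroBlock_modulus.comp huj).to_comp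
  have heq : ∀ c : ℕ, ComputablePred fun z : ℕ => z = c := fun c =>
    (Primrec.eq.comp Primrec.id (Primrec.const c)).computablePred
  exact (Primrec.nat_le.comp (Primrec.fst.comp hmu) he).computablePred.and
    (((heq 1).comp_computable hmod).or ((heq 2).comp_computable hmod))

theorem corollary5 (φ : ℕ → ℝ → ℝ)
    (hcomp : IsComputableFamilyOn (Set.Ioo 0 1) φ)
    (hC1 : ∀ k : ℕ, ContDiffOn ℝ 1 (φ k) (Set.Ioo 0 1))
    (hfin : ∀ k : ℕ, (criticalPointsOn (Set.Ioo 0 1) (φ k)).Finite)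
    (hcrit : ∀ k : ℕ, ∀ c ∈ criticalPointsOn (Set.Ioo 0 1) (φ k), IsComputableReal c) :
    ∃ x : ℝ, x ∈ Set.Ioo (0 : ℝ) 1 ∧ IsComputableReal x ∧
      ∀ k : ℕ, ¬ IsNormalNumber (φ k x) := by
  obtain ⟨F, hF, hFspec⟩ := hcomp
  obtain ⟨x, hx, hxc, hcert⟩ := exists_isComputableReal_of_dyadic_refinement
    -- The index i codes the pair (k, j), and w will code the prefix length m and the block start u.
    (computablePred_certifiesZeroBlock hF) fun i a e ha hae => by
      have he : (0 : ℝ) < 2 ^ e := by positivity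
      have hsub : Set.Ioo ((a : ℝ) / 2 ^ e) ((a + 1) / 2 ^ e) ⊆ Set.Ioo 0 1 :=
        Set.Ioo_subset_Ioo (by positivity) ((div_le_one he).2 (by exact_mod_cast hae.le))
      obtain ⟨x, hx, y, hy, hxy⟩ := exists_ne_of_finite_criticalPointsOn (hfin i.unpair.1)
        (div_lt_div_of_pos_right (lt_add_one (a : ℝ)) he) hsub
      obtain ⟨z, hz, u, s, hzv⟩ := exists_abs_eq_dyadic_add Set.ordConnected_Ioo
        ((hC1 i.unpair.1).continuousOn.mono hsub) hx hy hxy i.unpair.2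
      have hz0 : 0 ≤ z := (hsub hz).1.le
      obtain ⟨⟨m, q, hq⟩, hbound⟩ := hFspec i.unpair.1 z (hsub hz) _ (isRealName_floor hz0)
        (4 * (u + i.unpair.2 + 1) + 2)
      obtain ⟨t, r, hr, hm, heq⟩ := exists_child_eq_floor hz m
      refine ⟨t, r, Nat.pair m u, hr, ?_⟩
      simp only [Nat.unpair_pair]
      -- The prefix read off the subinterval is that of the floor name of z, on which the machine
      -- has already answered.
      refine ⟨hm, ?_⟩
      rw [heq, dyadicPrefix_floor z hm, outputNatAbs, hq]
      exact natAbs_mod_of_abs_eq_dyadic_add hzv (hbound m q hq)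
  refine ⟨x, hx, hxc, fun k => not_isNormalNumber_of_int_approx fun j => ?_⟩
  obtain ⟨a, e, w, hxa, hm, hmod⟩ := hcert (Nat.pair k j)
  simp only [Nat.unpair_pair] at hm hmod
  obtain ⟨p, hp, hpre⟩ := exists_isRealName_map_range_eq hx.1.le hxa hm
  refine ⟨w.unpair.2, ?_⟩
  cases hq : F k (dyadicPrefix a e w.unpair.1) (4 * (w.unpair.2 + j + 1) + 2) with
  -- A missing output counts as 0, whose residue is neither 1 nor 2.
  | none => simp [outputNatAbs, hq] at hmod
  | some q =>
    rw [outputNatAbs, hq] at hmod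
    rw [← hpre] at hq
    exact ⟨q, (hFspec k x hx p hp _).2 _ q hq, hmod⟩
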